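/- All graphs are finite and simple. Let $G=(V,E)$ be a connected graph with shortest-path distance $d$, and put $d(x,W)=\min\{d(x,w): w\in W\}$ for $x\in V$ and $\emptyset\ne W\subseteq V$. A vertex $v$ strongly resolves two different vertices $x,y$ if $d(x,v)=d(x,y)+d(y,v)$ or $d(y,v)=d(y,x)+d(x,v)$. A set $S\subseteq V$ is a strong resolving set if every two different vertices of $G$ are strongly resolved by some vertex of $S$. The strong metric dimension $\dim_s(G)$ is the minimum cardinality of a strong resolving set of $G$. A nonempty set $W\subseteq V$ strongly resolves two different vertices $x,y\notin W$ if $d(x,W)=d(x,y)+d(y,W)$ or $d(y,W)=d(y,x)+d(x,W)$. A partition $\Pi$ of $V$ into nonempty sets is a strong resolving partition if every two different vertices lying in the same set of $\Pi$ are strongly resolved by some set of $\Pi$. The strong partition dimension $pd_s(G)$ is the minimum number of sets in a strong resolving partition of $G$. **Theorem.** For any integers $r,t,n$ such that $3\le r<t\le \frac{n+r-2}{2}$ there exists a connected graph $G$ of order $n$ with $pd_s(G)=r$ and $\dim_s(G)=t$. -/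

import Mathlib

namespace StrongPartition

/-- The vertex `v` strongly resolves the vertices `x` and `y` in `G`. -/
def VertexStronglyResolves {V : Type*} (G : SimpleGraph V) (v x y : V) : Prop :=
  G.dist x v = G.dist x y + G.dist y v ∨ G.dist y v = G.dist y x + G.dist x v

/-- `S` is a strong resolving set of `G`: every two different vertices of `G` are strongly
resolved by some vertex of `S`. -/
def IsStrongResolvingSet {V : Type*} (G : SimpleGraph V) (S : Finset V) : Prop :=
  ∀ x y : V, x ≠ y → ∃ v ∈ S, VertexStronglyResolves G v x y

/-- The strong metric dimension: the minimum cardinality of a strong resolving set (the set of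
all vertices is always one, so the minimum is attained). -/
noncomputable def strongMetricDim {V : Type*} [Fintype V] (G : SimpleGraph V) : ℕ :=
  sInf {k : ℕ | ∃ S : Finset V, IsStrongResolvingSet G S ∧ S.card = k}

/-- The distance `d(x, W) = min {d(x, w) : w ∈ W}`; it is only used for nonempty `W`. -/
noncomputable def distToSet {V : Type*} (G : SimpleGraph V) (x : V) (W : Finset V) : ℕ :=
  sInf {d : ℕ | ∃ w ∈ W, G.dist x w = d}

/-- The set `W` strongly resolves `x` and `y`, both of which have to lie outside `W`. -/
def SetStronglyResolves {V : Type*} (G : SimpleGraph V) (W : Finset V) (x y : V) : Prop :=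
  x ∉ W ∧ y ∉ W ∧
    (distToSet G x W = G.dist x y + distToSet G y W ∨
      distToSet G y W = G.dist y x + distToSet G x W)

/-- `P`, a partition of the vertex set into nonempty parts, is a strong resolving partition
of `G`: every two different vertices in the same part are strongly resolved by some part. -/
def IsStrongResolvingPartition {V : Type*} [Fintype V] [DecidableEq V] (G : SimpleGraph V)
    (P : Finpartition (Finset.univ : Finset V)) : Prop :=
  ∀ U ∈ P.parts, ∀ x ∈ U, ∀ y ∈ U, x ≠ y → ∃ W ∈ P.parts, SetStronglyResolves G W x y

/-- The strong partition dimension: the minimum cardinality of a strong resolving partition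
(the partition into singletons is always one, so the minimum is attained). -/
noncomputable def strongPartitionDim {V : Type*} [Fintype V] [DecidableEq V]
    (G : SimpleGraph V) : ℕ :=
  sInf {k : ℕ | ∃ P : Finpartition (Finset.univ : Finset V),
    IsStrongResolvingPartition G P ∧ P.parts.card = k}

end StrongPartition

/-! Take an odd cycle of length `2k + 1` and attach to its vertex `0` a path of length `L + 1` and
`s` leaves. The order is `2k + L + s + 2`, and `r = s + 2`, `t = k + s + 1` turn the hypotheses into
`s ≥ 1`, `k ≥ 2`, `L ≥ 0`.

Both invariants depend on the pairs of mutually farthest vertices, which only their own members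
strongly resolve. The `s + 1` ends (path end and leaves) form a clique of such pairs, and each end
is paired with `k` and `k + 1`. On the cycle without `0`, the pairs at distance `k` form a path with
`2k` vertices whose ends are `k` and `k + 1`.

Partition dimension: `k` and the ends need different parts (`card_le_strongPartitionDim`).
Conversely, `s + 2` parts suffice: `{k, k + 1}`, two parts each lying on a geodesic that leaves this
pair, and the remaining leaves as singletons.

Metric dimension: the complement of a strong resolving set contains no mutually farthest pair.
Counting cycle vertices by a matching bounds its size by `k + L + 1`. Equality holds for a geodesic
from `k` to the path end, with that end removed. -/

namespace StrongPartition

/-! ### General facts on distances, resolution and partitions -/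

/-- A graph whose adjacency is "distance one" for a symmetric, separating function `D` that
changes by at most one along edges and along whose values one can descend, has `D` as distance
function. -/
theorem connected_and_dist_eq {V : Type*} [Nonempty V] (G : SimpleGraph V) (D : V → V → ℕ)
    (h0 : ∀ x y, D x y = 0 ↔ x = y)
    (hlip : ∀ x y z, G.Adj x z → D x y ≤ D z y + 1)
    (hstep : ∀ x y, x ≠ y → ∃ z, G.Adj x z ∧ D x y = D z y + 1) :
    G.Connected ∧ ∀ x y, G.dist x y = D x y := by
  have hwalk : ∀ m x y, D x y = m → ∃ p : G.Walk x y, p.length = m := by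
    intro m
    induction m with
    | zero =>
      intro x y h
      obtain rfl := (h0 x y).1 h
      exact ⟨SimpleGraph.Walk.nil, rfl⟩
    | succ m ih =>
      intro x y h
      have hne : x ≠ y := fun e => by
        have := (h0 x y).2 e
        omega
      obtain ⟨z, hz, hd⟩ := hstep x y hne
      obtain ⟨p, hp⟩ := ih z y (by omega)
      exact ⟨SimpleGraph.Walk.cons hz p, by simp [hp]⟩
  have hlow : ∀ x y (p : G.Walk x y), D x y ≤ p.length := by
    intro x y p
    induction p with
    | nil => simp [h0]
    | cons h p ih =>
      rw [SimpleGraph.Walk.length_cons]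
      exact (hlip _ _ _ h).trans (Nat.add_le_add_right ih 1)
  have hconn : G.Connected :=
    { preconnected := fun x y => by
        obtain ⟨p, -⟩ := hwalk _ x y rfl
        exact ⟨p⟩ }
  refine ⟨hconn, fun x y => le_antisymm ?_ ?_⟩
  · obtain ⟨p, hp⟩ := hwalk _ x y rfl
    exact hp ▸ SimpleGraph.dist_le p
  · obtain ⟨p, hp⟩ := hconn.exists_walk_length_eq_dist x y
    exact hp ▸ hlow x y p

theorem distToSet_eq {V : Type*} {G : SimpleGraph V} {x w : V} {W : Finset V} (hw : w ∈ W)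
    (hmin : ∀ v ∈ W, G.dist x w ≤ G.dist x v) : distToSet G x W = G.dist x w := by
  refine le_antisymm (Nat.sInf_le ⟨w, hw, rfl⟩) (le_csInf ⟨_, w, hw, rfl⟩ ?_)
  rintro d ⟨v, hv, rfl⟩
  exact hmin v hv

theorem exists_dist_eq_distToSet {V : Type*} (G : SimpleGraph V) (x : V) {W : Finset V}
    (hW : W.Nonempty) : ∃ w ∈ W, G.dist x w = distToSet G x W := by
  obtain ⟨w, hw⟩ := hW
  exact Nat.sInf_mem (s := {d : ℕ | ∃ w ∈ W, G.dist x w = d}) ⟨_, w, hw, rfl⟩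

theorem distToSet_le {V : Type*} (G : SimpleGraph V) (x : V) {w : V} {W : Finset V}
    (hw : w ∈ W) : distToSet G x W ≤ G.dist x w :=
  Nat.sInf_le ⟨w, hw, rfl⟩

/-- If a set strongly resolves two vertices, then so does one of its members. -/
theorem SetStronglyResolves.exists_vertex {V : Type*} {G : SimpleGraph V} (hG : G.Connected)
    {W : Finset V} (hW : W.Nonempty) {x y : V} (h : SetStronglyResolves G W x y) :
    ∃ w, w ≠ x ∧ w ≠ y ∧ VertexStronglyResolves G w x y := by
  obtain ⟨hx, hy, h | h⟩ := h
  -- The vertex of `W` nearest to `y` works: the triangle inequality forces it to be nearest to `x`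
  -- too.
  · obtain ⟨w, hw, hd⟩ := exists_dist_eq_distToSet G y hW
    refine ⟨w, fun e => hx (e ▸ hw), fun e => hy (e ▸ hw), Or.inl ?_⟩
    have := distToSet_le G x hw
    have := hG.dist_triangle (u := x) (v := y) (w := w)
    omega
  · obtain ⟨w, hw, hd⟩ := exists_dist_eq_distToSet G x hW
    refine ⟨w, fun e => hx (e ▸ hw), fun e => hy (e ▸ hw), Or.inr ?_⟩
    have := distToSet_le G y hw
    have := hG.dist_triangle (u := y) (v := x) (w := w)
    omega

/-- Pairwise mutually maximally distant vertices lie in different parts of a strong resolving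
partition. -/
theorem card_le_strongPartitionDim {V : Type*} [Fintype V] [DecidableEq V] {G : SimpleGraph V}
    (hG : G.Connected) (K : Finset V)
    (hK : ∀ x ∈ K, ∀ y ∈ K, x ≠ y → ∀ w, VertexStronglyResolves G w x y → w = x ∨ w = y)
    (hne : ∃ k, ∃ P : Finpartition (Finset.univ : Finset V),
      IsStrongResolvingPartition G P ∧ P.parts.card = k) :
    K.card ≤ strongPartitionDim G := by
  refine le_csInf hne ?_
  rintro _ ⟨P, hP, rfl⟩
  refine Finset.card_le_card_of_injOn P.part
    (fun x _ => P.part_mem.2 (Finset.mem_univ x)) ?_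
  intro x hx y hy hxy
  by_contra hne
  have hyx : y ∈ P.part x := by
    rw [hxy]
    exact P.mem_part (Finset.mem_univ y)
  obtain ⟨W, hW, hres⟩ := hP _ (P.part_mem.2 (Finset.mem_univ x)) x
    (P.mem_part (Finset.mem_univ x)) y hyx hne
  obtain ⟨w, hwx, hwy, hw⟩ := hres.exists_vertex hG (P.nonempty_of_mem_parts hW)
  rcases hK x hx y hy hne w hw with h | h
  exacts [hwx h, hwy h]

/-- A colouring with nonempty colour classes gives a partition. -/
theorem exists_finpartition_of_colouring {V κ : Type*} [Fintype V] [DecidableEq V] [Fintype κ]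
    [DecidableEq κ] (f : V → κ) (hf : Function.Surjective f) :
    ∃ P : Finpartition (Finset.univ : Finset V), P.parts.card ≤ Fintype.card κ ∧
      ∀ U, U ∈ P.parts ↔ ∃ c, Finset.univ.filter (fun v => f v = c) = U := by
  refine ⟨⟨Finset.univ.image fun c => Finset.univ.filter fun v => f v = c, ?_, ?_, ?_⟩,
    Finset.card_image_le, fun U => by simp⟩
  · rw [Finset.supIndep_iff_pairwiseDisjoint]
    intro A hA B hB hAB
    simp only [Finset.coe_image, Finset.coe_univ, Set.image_univ, Set.mem_range] at hA hB
    obtain ⟨a, rfl⟩ := hA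
    obtain ⟨b, rfl⟩ := hB
    refine Finset.disjoint_left.2 fun v hv hv' => hAB ?_
    simp only [id, Finset.mem_filter, Finset.mem_univ, true_and] at hv hv'
    rw [← hv, ← hv']
  · refine le_antisymm (Finset.subset_univ _) fun v _ => ?_
    rw [Finset.mem_sup]
    exact ⟨_, Finset.mem_image_of_mem _ (Finset.mem_univ (f v)), by simp⟩
  · intro h
    obtain ⟨c, -, hc⟩ := Finset.mem_image.1 h
    obtain ⟨v, hv⟩ := hf c
    have : v ∈ (⊥ : Finset V) := hc ▸ by simp [hv]
    simp at this

/-! ### The distance function of the tadpole, on natural numbers -/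

/-- Distance on the cycle with vertices `0, …, 2k`. -/
def cycleDist (k x y : ℕ) : ℕ :=
  min ((x - y) + (y - x)) (2 * k + 1 - ((x - y) + (y - x)))

/-- The vertex of the cycle nearest to `x`. -/
def foot (k x : ℕ) : ℕ := if x ≤ 2 * k then x else 0

/-- The distance from `x` to the cycle. -/
def height (k L x : ℕ) : ℕ :=
  if x ≤ 2 * k then 0 else if x ≤ 2 * k + L + 1 then x - 2 * k else 1

/-- The distance in the graph that consists of a cycle `0, …, 2k`, a path
`2k + 1, …, 2k + L + 1` attached to the vertex `0`, and leaves `2k + L + 2, …` attached to `0`. -/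
def tadpoleDist (k L x y : ℕ) : ℕ :=
  if x = y then 0
  else if 2 * k < x ∧ x ≤ 2 * k + L + 1 ∧ 2 * k < y ∧ y ≤ 2 * k + L + 1 then (x - y) + (y - x)
  else height k L x + height k L y + cycleDist k (foot k x) (foot k y)

theorem tadpoleDist_self (k L x : ℕ) : tadpoleDist k L x x = 0 := by simp [tadpoleDist]

theorem tadpoleDist_comm (k L x y : ℕ) : tadpoleDist k L x y = tadpoleDist k L y x := by
  simp only [tadpoleDist, height, cycleDist, foot]
  split_ifs <;> omega

theorem tadpoleDist_eq_zero (k L x y : ℕ) : tadpoleDist k L x y = 0 ↔ x = y := by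
  simp only [tadpoleDist, height, cycleDist, foot]
  split_ifs <;> omega

theorem tadpoleDist_cycle {k x y : ℕ} (L : ℕ) (hx : x ≤ 2 * k) (hy : y ≤ 2 * k) :
    tadpoleDist k L x y = cycleDist k x y := by
  simp only [tadpoleDist, height, cycleDist, foot]
  split_ifs <;> omega

theorem tadpoleDist_cycle_left {k x y : ℕ} (L : ℕ) (hx : x ≤ 2 * k) (hy : 2 * k < y) :
    tadpoleDist k L x y = height k L y + cycleDist k x 0 := by
  simp only [tadpoleDist, height, cycleDist, foot]
  split_ifs <;> omega

theorem tadpoleDist_path {k L x y : ℕ} (hx : 2 * k < x) (hx' : x ≤ 2 * k + L + 1)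
    (hy : 2 * k < y) (hy' : y ≤ 2 * k + L + 1) :
    tadpoleDist k L x y = (x - y) + (y - x) := by
  simp only [tadpoleDist]
  split_ifs <;> omega

theorem tadpoleDist_path_left {k L x y : ℕ} (hx : 2 * k < x) (hx' : x ≤ 2 * k + L + 1)
    (hy : ¬ (2 * k < y ∧ y ≤ 2 * k + L + 1)) :
    tadpoleDist k L x y = (x - 2 * k) + tadpoleDist k L 0 y := by
  simp only [tadpoleDist, height, cycleDist, foot]
  split_ifs <;> omega

theorem tadpoleDist_leaf_left {k L x y : ℕ} (hx : 2 * k + L + 1 < x) (h : x ≠ y) :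
    tadpoleDist k L x y = tadpoleDist k L 0 y + 1 := by
  simp only [tadpoleDist, height, cycleDist, foot]
  split_ifs <;> omega

/-- One orientation of the edges. -/
theorem cases_of_tadpoleDist_eq_one {k L x z : ℕ} (h : tadpoleDist k L x z = 1) (hxz : x < z) :
    (z = x + 1 ∧ z ≤ 2 * k) ∨ (x = 0 ∧ z = 2 * k) ∨
      (2 * k < x ∧ z = x + 1 ∧ z ≤ 2 * k + L + 1) ∨ (x = 0 ∧ z = 2 * k + 1) ∨
      (x = 0 ∧ 2 * k + L + 1 < z) := by
  simp only [tadpoleDist, height, cycleDist, foot] at h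
  split_ifs at h <;> omega

theorem tadpoleDist_edge {k L x z : ℕ} (y : ℕ) (h : tadpoleDist k L x z = 1) (hxz : x < z) :
    tadpoleDist k L x y ≤ tadpoleDist k L z y + 1 ∧
      tadpoleDist k L z y ≤ tadpoleDist k L x y + 1 := by
  rcases cases_of_tadpoleDist_eq_one h hxz with
    ⟨rfl, h1⟩ | ⟨rfl, rfl⟩ | ⟨h1, rfl, h2⟩ | ⟨rfl, rfl⟩ | ⟨rfl, h1⟩
  · rcases le_or_gt y (2 * k) with hy | hy
    · rw [tadpoleDist_cycle L (by omega) hy, tadpoleDist_cycle L h1 hy]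
      simp only [cycleDist]
      omega
    · rw [tadpoleDist_cycle_left L (by omega) hy, tadpoleDist_cycle_left L h1 hy]
      simp only [cycleDist]
      omega
  · rcases le_or_gt y (2 * k) with hy | hy
    · rw [tadpoleDist_cycle L (by omega) hy, tadpoleDist_cycle L le_rfl hy]
      simp only [cycleDist]
      omega
    · rw [tadpoleDist_cycle_left L (by omega) hy, tadpoleDist_cycle_left L le_rfl hy]
      simp only [cycleDist]
      omega
  · by_cases hy : 2 * k < y ∧ y ≤ 2 * k + L + 1
    · rw [tadpoleDist_path h1 (by omega) hy.1 hy.2, tadpoleDist_path (by omega) h2 hy.1 hy.2]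
      omega
    · rw [tadpoleDist_path_left h1 (by omega) hy, tadpoleDist_path_left (by omega) h2 hy]
      omega
  · by_cases hy : 2 * k < y ∧ y ≤ 2 * k + L + 1
    · rw [tadpoleDist_path (x := 2 * k + 1) (by omega) (by omega) hy.1 hy.2,
        tadpoleDist_cycle_left L (x := 0) (by omega) hy.1]
      simp only [cycleDist, height]
      split_ifs <;> omega
    · rw [tadpoleDist_path_left (x := 2 * k + 1) (by omega) (by omega) hy]
      omega
  · rcases eq_or_ne z y with rfl | hy
    · rw [tadpoleDist_self]
      omega
    · rw [tadpoleDist_leaf_left h1 hy]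
      omega

theorem tadpoleDist_le_add_one (k L x y z : ℕ) (h : tadpoleDist k L x z = 1) :
    tadpoleDist k L x y ≤ tadpoleDist k L z y + 1 := by
  rcases lt_trichotomy x z with hxz | rfl | hxz
  · exact (tadpoleDist_edge y h hxz).1
  · omega
  · exact (tadpoleDist_edge y (tadpoleDist_comm k L x z ▸ h) hxz).2

/-- Every vertex `x ≠ y` has a neighbour on a shortest path to `y`. -/
theorem exists_tadpoleDist_step {k L x y n : ℕ} (hk : 2 ≤ k) (hn : 2 * k + L + 2 ≤ n)
    (hx : x < n) (hy : y < n) (h : x ≠ y) :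
    ∃ z < n, tadpoleDist k L x z = 1 ∧ tadpoleDist k L x y = tadpoleDist k L z y + 1 := by
  rcases lt_or_ge (2 * k + L + 1) x with hxl | hxl
  · refine ⟨0, by omega, ?_, tadpoleDist_leaf_left hxl h⟩
    rw [tadpoleDist_leaf_left hxl (by omega), tadpoleDist_self]
  rcases lt_or_ge (2 * k) x with hxp | hxc
  · by_cases hyp : 2 * k < y ∧ y ≤ 2 * k + L + 1
    · rcases lt_or_gt_of_ne h with hlt | hlt
      · refine ⟨x + 1, by omega, ?_, ?_⟩ <;>
        · repeat rw [tadpoleDist_path (by omega) (by omega) (by omega) (by omega)]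
          omega
      · refine ⟨x - 1, by omega, ?_, ?_⟩ <;>
        · repeat rw [tadpoleDist_path (by omega) (by omega) (by omega) (by omega)]
          omega
    · rcases eq_or_lt_of_le (Nat.succ_le_of_lt hxp) with rfl | hlt
      · refine ⟨0, by omega, ?_, ?_⟩
        · rw [tadpoleDist_path_left (by omega) (by omega) (by omega), tadpoleDist_self]
          omega
        · rw [tadpoleDist_path_left (by omega) (by omega) hyp]
          omega
      · refine ⟨x - 1, by omega, ?_, ?_⟩
        · rw [tadpoleDist_path (by omega) (by omega) (by omega) (by omega)]
          omega
        · rw [tadpoleDist_path_left hxp hxl hyp,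
            tadpoleDist_path_left (x := x - 1) (by omega) (by omega) hyp]
          omega
  -- Move around the cycle the shorter way; `hdir` says that this way is increasing. For `y` off the
  -- cycle the target is `f = 0`.
  have key : ∀ f ≤ 2 * k, x ≠ f → ∃ z ≤ 2 * k, cycleDist k x z = 1 ∧
      cycleDist k x f = cycleDist k z f + 1 := by
    intro f hf hxf
    simp only [cycleDist]
    by_cases hdir : x < f ∧ f - x ≤ k ∨ f < x ∧ k < x - f
    · rcases eq_or_lt_of_le hxc with rfl | hlt
      · exact ⟨0, by omega, by omega, by omega⟩
      · exact ⟨x + 1, by omega, by omega, by omega⟩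
    · rcases Nat.eq_zero_or_pos x with rfl | hpos
      · exact ⟨2 * k, by omega, by omega, by omega⟩
      · exact ⟨x - 1, by omega, by omega, by omega⟩
  rcases le_or_gt y (2 * k) with hyc | hyc
  · obtain ⟨z, hz, h1, h2⟩ := key y hyc h
    refine ⟨z, by omega, ?_, ?_⟩
    · rwa [tadpoleDist_cycle L hxc hz]
    · rwa [tadpoleDist_cycle L hxc hyc, tadpoleDist_cycle L hz hyc]
  · rcases Nat.eq_zero_or_pos x with rfl | hpos
    · by_cases hyl : y ≤ 2 * k + L + 1
      · refine ⟨2 * k + 1, by omega, ?_, ?_⟩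
        · rw [tadpoleDist_cycle_left L (by omega) (by omega)]
          simp only [cycleDist, height]
          split_ifs <;> omega
        · rw [tadpoleDist_cycle_left L (by omega) hyc,
            tadpoleDist_path (by omega) (by omega) hyc hyl]
          simp only [cycleDist, height]
          split_ifs <;> omega
      · have h1 : tadpoleDist k L 0 y = 1 := by
          rw [tadpoleDist_comm, tadpoleDist_leaf_left (by omega) (by omega), tadpoleDist_self]
        exact ⟨y, hy, h1, by rw [tadpoleDist_self, h1]⟩
    · obtain ⟨z, hz, h1, h2⟩ := key 0 (by omega) (by omega)
      refine ⟨z, by omega, ?_, ?_⟩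
      · rwa [tadpoleDist_cycle L hxc hz]
      · rw [tadpoleDist_cycle_left L hxc hyc, tadpoleDist_cycle_left L hz hyc, h2, add_assoc]

/-! ### The graph and its metric -/

/-- The cycle `0, …, 2k` with a path of length `L + 1` and further leaves attached to `0`. -/
def tadpole (k L n : ℕ) : SimpleGraph (Fin n) where
  Adj x y := tadpoleDist k L x y = 1
  symm := ⟨fun x y h => by rwa [tadpoleDist_comm]⟩
  loopless := ⟨fun x h => by
    rw [tadpoleDist_self] at h
    omega⟩

theorem tadpole_connected_and_dist {k L n : ℕ} (hk : 2 ≤ k) (hn : 2 * k + L + 2 ≤ n) :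
    (tadpole k L n).Connected ∧
      ∀ x y : Fin n, (tadpole k L n).dist x y = tadpoleDist k L x y := by
  have : Nonempty (Fin n) := ⟨⟨0, by omega⟩⟩
  refine connected_and_dist_eq (tadpole k L n) (fun x y => tadpoleDist k L x y) (fun x y => ?_)
    (fun x y z h => tadpoleDist_le_add_one k L x y z h) (fun x y h => ?_)
  · rw [tadpoleDist_eq_zero, Fin.ext_iff]
  · obtain ⟨z, hz, h1, h2⟩ := exists_tadpoleDist_step hk hn x.2 y.2 (Fin.val_ne_of_ne h)
    exact ⟨⟨z, hz⟩, h1, h2⟩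

/-- `tadpoleDist` does not involve the order of the graph, so the inequality is inherited from a
tadpole large enough to contain all three vertices. -/
theorem tadpoleDist_triangle {k : ℕ} (L x y z : ℕ) (hk : 2 ≤ k) :
    tadpoleDist k L x z ≤ tadpoleDist k L x y + tadpoleDist k L y z := by
  obtain ⟨hc, hd⟩ :=
    tadpole_connected_and_dist (L := L) (n := 2 * k + L + 2 + x + y + z) hk (by omega)
  have := hc.dist_triangle (u := ⟨x, by omega⟩) (v := ⟨y, by omega⟩) (w := ⟨z, by omega⟩)
  simpa only [hd] using this

/-! ### Mutually farthest pairs -/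

/-- No vertex other than `y` is reached from `x` by a shortest path through `y`. -/
def IsFarthest (k L x y : ℕ) : Prop :=
  ∀ w, w ≠ y → tadpoleDist k L x w ≠ tadpoleDist k L x y + tadpoleDist k L y w

/-- An end has a single neighbour `p`, through which all its shortest paths start. -/
theorem exists_tadpoleDist_end {k L y : ℕ} (hy : 2 * k + L + 1 ≤ y) :
    ∃ p, ∀ v, y ≠ v → tadpoleDist k L y v = tadpoleDist k L p v + 1 := by
  rcases eq_or_lt_of_le hy with rfl | hlt
  · rcases Nat.eq_zero_or_pos L with rfl | hL
    · refine ⟨0, fun v hv => ?_⟩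
      rw [tadpoleDist_path_left (x := 2 * k + 0 + 1) (by omega) (by omega) (by omega)]
      omega
    · refine ⟨2 * k + L, fun v hv => ?_⟩
      by_cases hvp : 2 * k < v ∧ v ≤ 2 * k + L + 1
      · rw [tadpoleDist_path (x := 2 * k + L + 1) (by omega) (by omega) hvp.1 hvp.2,
          tadpoleDist_path (x := 2 * k + L) (by omega) (by omega) hvp.1 hvp.2]
        omega
      · rw [tadpoleDist_path_left (x := 2 * k + L + 1) (by omega) (by omega) hvp,
          tadpoleDist_path_left (x := 2 * k + L) (by omega) (by omega) hvp]
        omega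
  · exact ⟨0, fun v hv => tadpoleDist_leaf_left hlt hv⟩

theorem isFarthest_end {k L x y : ℕ} (hk : 2 ≤ k) (hy : 2 * k + L + 1 ≤ y) (hxy : x ≠ y) :
    IsFarthest k L x y := by
  intro w hw
  obtain ⟨p, hp⟩ := exists_tadpoleDist_end hy
  have h1 := hp w hw.symm
  have h2 := hp x hxy.symm
  have h3 := tadpoleDist_triangle L x p w hk
  rw [tadpoleDist_comm k L x y]
  rw [tadpoleDist_comm k L x p] at h3
  omega

theorem tadpoleDist_zero_add {k L x y : ℕ} (hx : 2 * k + L + 1 ≤ x) (hy : y ≤ 2 * k) :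
    tadpoleDist k L x y = tadpoleDist k L x 0 + cycleDist k 0 y := by
  simp only [tadpoleDist, height, cycleDist, foot]
  split_ifs <;> omega

/-- No cycle distance exceeds `k`, and vertices off the cycle are reached through `0`; hence `y ≠
0`. -/
theorem isFarthest_cycle {k L x y : ℕ} (hx : x ≤ 2 * k) (hy : y ≤ 2 * k)
    (hy0 : y ≠ 0) (hxy : cycleDist k x y = k) : IsFarthest k L x y := by
  intro w hw
  rw [tadpoleDist_cycle L hx hy, hxy]
  rcases le_or_gt w (2 * k) with hwc | hwc
  · rw [tadpoleDist_cycle L hx hwc, tadpoleDist_cycle L hy hwc]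
    simp only [cycleDist]
    omega
  · rw [tadpoleDist_cycle_left L hx hwc, tadpoleDist_cycle_left L hy hwc]
    simp only [cycleDist]
    omega

theorem isFarthest_end_left {k L x y : ℕ} (hk : 2 ≤ k) (hx : 2 * k + L + 1 ≤ x)
    (hy : y ≤ 2 * k) (h0y : cycleDist k 0 y = k) : IsFarthest k L x y := by
  intro w hw
  have hy0 : y ≠ 0 := by
    rintro rfl
    simp [cycleDist] at h0y
    omega
  have h1 := isFarthest_cycle (L := L) (Nat.zero_le _) hy hy0 h0y w hw
  have h2 := tadpoleDist_triangle L x 0 w hk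
  have h3 := tadpoleDist_triangle L 0 y w hk
  rw [tadpoleDist_zero_add hx hy, ← tadpoleDist_cycle L (Nat.zero_le _) hy]
  omega

theorem eq_or_eq_of_vertexStronglyResolves {k L n : ℕ} (hk : 2 ≤ k) (hn : 2 * k + L + 2 ≤ n)
    {x y w : Fin n} (hxy : IsFarthest k L x y) (hyx : IsFarthest k L y x)
    (h : VertexStronglyResolves (tadpole k L n) w x y) : w = x ∨ w = y := by
  simp only [VertexStronglyResolves, (tadpole_connected_and_dist hk hn).2] at h
  by_contra! hne
  rcases h with h | h
  · exact hxy w (Fin.val_ne_of_ne hne.2) h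
  · exact hyx w (Fin.val_ne_of_ne hne.1) h

theorem cycleDist_zero_left {k : ℕ} : cycleDist k 0 k = k := by
  simp only [cycleDist]
  omega

/-! ### The strong partition dimension -/

/-- The colouring whose classes form a strong resolving partition. -/
def tadpoleColour (k L x : ℕ) : ℕ :=
  if x = k ∨ x = k + 1 then 0
  else if x < k ∨ 2 * k < x ∧ x ≤ 2 * k + L + 1 then 1
  else if x ≤ 2 * k then 2
  else x - (2 * k + L)

theorem tadpoleColour_eq_zero {k L x : ℕ} : tadpoleColour k L x = 0 ↔ x = k ∨ x = k + 1 := by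
  grind [tadpoleColour]

theorem tadpoleColour_eq_one {k L x : ℕ} :
    tadpoleColour k L x = 1 ↔ x < k ∨ 2 * k < x ∧ x ≠ k + 1 ∧ x ≤ 2 * k + L + 1 := by
  grind [tadpoleColour]

theorem tadpoleColour_eq_two {k L x : ℕ} (hk : 2 ≤ k) :
    tadpoleColour k L x = 2 ↔ k + 2 ≤ x ∧ x ≤ 2 * k ∨ x = 2 * k + L + 2 := by
  grind [tadpoleColour]

theorem eq_of_tadpoleColour {k L x : ℕ} (h : 3 ≤ tadpoleColour k L x) :
    x = tadpoleColour k L x + (2 * k + L) := by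
  simp only [tadpoleColour] at h ⊢
  split_ifs at h ⊢ <;> omega

/-- The distance to `k` on the second class. -/
theorem tadpoleDist_left_apex {k L x : ℕ} (hk : 2 ≤ k) (hx : tadpoleColour k L x = 1) :
    tadpoleDist k L x k = (if x < k then k - x else x - k) ∧
      tadpoleDist k L x k ≤ tadpoleDist k L x (k + 1) := by
  rw [tadpoleColour_eq_one] at hx
  simp only [tadpoleDist, height, cycleDist, foot]
  split_ifs <;> omega

/-- The distance to `k + 1` on the third class. -/
theorem tadpoleDist_right_apex {k L x : ℕ} (hk : 2 ≤ k) (hx : tadpoleColour k L x = 2) :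
    tadpoleDist k L x (k + 1) = (if x ≤ 2 * k then x - (k + 1) else k + 1) ∧
      tadpoleDist k L x (k + 1) ≤ tadpoleDist k L x k := by
  rw [tadpoleColour_eq_two hk] at hx
  simp only [tadpoleDist, height, cycleDist, foot]
  split_ifs <;> omega

/-- The class lies on the geodesic from `k` down to `0` and out along the path. -/
theorem tadpoleDist_eq_of_colour_one {k L x y : ℕ} (hk : 2 ≤ k) (hx : tadpoleColour k L x = 1)
    (hy : tadpoleColour k L y = 1) :
    tadpoleDist k L x k = tadpoleDist k L x y + tadpoleDist k L y k ∨
      tadpoleDist k L y k = tadpoleDist k L x y + tadpoleDist k L x k := by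
  rw [(tadpoleDist_left_apex hk hx).1, (tadpoleDist_left_apex hk hy).1]
  rw [tadpoleColour_eq_one] at hx hy
  simp only [tadpoleDist, height, cycleDist, foot]
  split_ifs <;> omega

/-- The class lies on the geodesic from `k + 1` up to `2k`, then through `0` to the first leaf. -/
theorem tadpoleDist_eq_of_colour_two {k L x y : ℕ} (hk : 2 ≤ k) (hx : tadpoleColour k L x = 2)
    (hy : tadpoleColour k L y = 2) :
    tadpoleDist k L x (k + 1) = tadpoleDist k L x y + tadpoleDist k L y (k + 1) ∨
      tadpoleDist k L y (k + 1) = tadpoleDist k L x y + tadpoleDist k L x (k + 1) := by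
  rw [(tadpoleDist_right_apex hk hx).1, (tadpoleDist_right_apex hk hy).1]
  rw [tadpoleColour_eq_two hk] at hx hy
  simp only [tadpoleDist, height, cycleDist, foot]
  split_ifs <;> omega

theorem two_le_tadpoleDist {k L x : ℕ} (hk : 2 ≤ k) (hx : tadpoleColour k L x = 1) :
    2 ≤ tadpoleDist k L (k + 1) x := by
  rw [tadpoleColour_eq_one] at hx
  simp only [tadpoleDist, height, cycleDist, foot]
  split_ifs <;> omega

theorem tadpoleDist_pred {k L : ℕ} (hk : 2 ≤ k) :
    tadpoleDist k L k (k - 1) = 1 ∧ tadpoleDist k L (k + 1) (k - 1) = 2 ∧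
      tadpoleDist k L k (k + 1) = 1 := by
  rw [tadpoleDist_cycle L (by omega) (by omega), tadpoleDist_cycle L (by omega) (by omega),
    tadpoleDist_cycle L (by omega) (by omega)]
  simp only [cycleDist]
  omega

theorem exists_strongResolvingPartition {k L s : ℕ} (hk : 2 ≤ k) (hs : 1 ≤ s) :
    ∃ P : Finpartition (Finset.univ : Finset (Fin (2 * k + L + s + 2))),
      IsStrongResolvingPartition (tadpole k L (2 * k + L + s + 2)) P ∧ P.parts.card ≤ s + 2 := by
  obtain ⟨-, hd⟩ := tadpole_connected_and_dist (n := 2 * k + L + s + 2) (L := L) hk (by omega)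
  let f : Fin (2 * k + L + s + 2) → Fin (s + 2) := fun x => ⟨tadpoleColour k L x, by
    have := x.2
    simp only [tadpoleColour]
    split_ifs <;> omega⟩
  have hf : Function.Surjective f := by
    rintro ⟨c, hc⟩
    rcases (by omega : c = 0 ∨ c = 1 ∨ 2 ≤ c) with rfl | rfl | h2
    · exact ⟨⟨k, by omega⟩, Fin.ext (tadpoleColour_eq_zero.2 (Or.inl rfl))⟩
    · exact ⟨⟨0, by omega⟩, Fin.ext (tadpoleColour_eq_one.2 (Or.inl (by omega : 0 < k)))⟩
    · refine ⟨⟨2 * k + L + c, by omega⟩, Fin.ext ?_⟩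
      simp only [f, tadpoleColour]
      split_ifs <;> omega
  obtain ⟨P, hcard, hP⟩ := exists_finpartition_of_colouring f hf
  rw [Fintype.card_fin] at hcard
  refine ⟨P, ?_, hcard⟩
  have hmem : ∀ (c : Fin (s + 2)) x, x ∈ Finset.univ.filter (fun v => f v = c) ↔
      tadpoleColour k L x = c := by
    intro c x
    simp [f, Fin.ext_iff]
  intro U hU x hx y hy hxy
  obtain ⟨c, rfl⟩ := (hP U).1 hU
  rw [hmem] at hx hy
  have hxy' := Fin.val_ne_of_ne hxy
  rcases (by omega : c.val = 0 ∨ c.val = 1 ∨ c.val = 2 ∨ 3 ≤ c.val) with hc | hc | hc | hc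
  -- The pair `k`, `k + 1` is resolved by class 1, at distances 1 and 2, both attained at `k - 1`.
  · have h1 : 1 < s + 2 := by omega
    have hdist : ∀ v : Fin (2 * k + L + s + 2), v.val = k ∨ v.val = k + 1 →
        distToSet (tadpole k L _) v (Finset.univ.filter fun u => f u = ⟨1, h1⟩) =
          tadpoleDist k L v (k - 1) := by
      intro v hv
      rw [distToSet_eq (w := ⟨k - 1, by omega⟩), hd]
      · rw [hmem]
        exact tadpoleColour_eq_one.2 (Or.inl (by simp only; omega))
      · intro u hu
        rw [hmem] at hu
        rw [hd, hd]
        obtain ⟨e1, e2, -⟩ := tadpoleDist_pred (L := L) hk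
        rcases hv with hv | hv
        · rw [hv, e1, Nat.one_le_iff_ne_zero, Ne, tadpoleDist_eq_zero]
          have := tadpoleColour_eq_one.1 hu
          omega
        · rw [hv, e2]
          exact two_le_tadpoleDist hk hu
    rw [hc] at hx hy
    have hx' := tadpoleColour_eq_zero.1 hx
    have hy' := tadpoleColour_eq_zero.1 hy
    refine ⟨_, (hP _).2 ⟨⟨1, h1⟩, rfl⟩, ?_, ?_, ?_⟩
    · intro h
      rw [hmem, hx] at h
      simp at h
    · intro h
      rw [hmem, hy] at h
      simp at h
    · rw [hdist x hx', hdist y hy', hd, hd]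
      obtain ⟨e1, e2, e3⟩ := tadpoleDist_pred (L := L) hk
      have e4 := tadpoleDist_comm k L k (k + 1)
      rcases hx' with hx' | hx' <;> rcases hy' with hy' | hy' <;> rw [hx', hy'] <;> omega
  all_goals have h0 : 0 < s + 2 := by omega
  · rw [hc] at hx hy
    have hdist : ∀ v : Fin (2 * k + L + s + 2), tadpoleColour k L v = 1 →
        distToSet (tadpole k L _) v (Finset.univ.filter fun u => f u = ⟨0, h0⟩) =
          tadpoleDist k L v k := by
      intro v hv
      rw [distToSet_eq (w := ⟨k, by omega⟩), hd]
      · rw [hmem]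
        exact tadpoleColour_eq_zero.2 (Or.inl rfl)
      · intro u hu
        rw [hmem] at hu
        rw [hd, hd]
        rcases tadpoleColour_eq_zero.1 hu with hu | hu <;> rw [hu]
        exact (tadpoleDist_left_apex hk hv).2
    refine ⟨_, (hP _).2 ⟨⟨0, h0⟩, rfl⟩, ?_, ?_, ?_⟩
    · intro h
      rw [hmem, hx] at h
      simp at h
    · intro h
      rw [hmem, hy] at h
      simp at h
    · rw [hdist x hx, hdist y hy, hd, hd, tadpoleDist_comm k L y x]
      exact tadpoleDist_eq_of_colour_one hk hx hy
  · rw [hc] at hx hy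
    have hdist : ∀ v : Fin (2 * k + L + s + 2), tadpoleColour k L v = 2 →
        distToSet (tadpole k L _) v (Finset.univ.filter fun u => f u = ⟨0, h0⟩) =
          tadpoleDist k L v (k + 1) := by
      intro v hv
      rw [distToSet_eq (w := ⟨k + 1, by omega⟩), hd]
      · rw [hmem]
        exact tadpoleColour_eq_zero.2 (Or.inr rfl)
      · intro u hu
        rw [hmem] at hu
        rw [hd, hd]
        rcases tadpoleColour_eq_zero.1 hu with hu | hu <;> rw [hu]
        exact (tadpoleDist_right_apex hk hv).2
    refine ⟨_, (hP _).2 ⟨⟨0, h0⟩, rfl⟩, ?_, ?_, ?_⟩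
    · intro h
      rw [hmem, hx] at h
      simp at h
    · intro h
      rw [hmem, hy] at h
      simp at h
    · rw [hdist x hx, hdist y hy, hd, hd, tadpoleDist_comm k L y x]
      exact tadpoleDist_eq_of_colour_two hk hx hy
  -- Classes from 3 on are single leaves.
  · have h1 := eq_of_tadpoleColour (hx ▸ hc)
    have h2 := eq_of_tadpoleColour (hy ▸ hc)
    omega

theorem strongPartitionDim_tadpole {k L s : ℕ} (hk : 2 ≤ k) (hs : 1 ≤ s) :
    strongPartitionDim (tadpole k L (2 * k + L + s + 2)) = s + 2 := by
  obtain ⟨P, hP, hcard⟩ := exists_strongResolvingPartition (L := L) hk hs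
  have hle : strongPartitionDim (tadpole k L (2 * k + L + s + 2)) ≤ P.parts.card :=
    Nat.sInf_le ⟨P, hP, rfl⟩
  refine le_antisymm (hle.trans hcard) ?_
  have hn : 2 * k + L + 2 ≤ 2 * k + L + s + 2 := by omega
  -- The pairwise mutually farthest vertices: `k` and the `s + 1` ends.
  let g : Fin (s + 2) → Fin (2 * k + L + s + 2) := fun i =>
    ⟨if i.val = 0 then k else 2 * k + L + i, by split_ifs <;> omega⟩
  have hg : Function.Injective g := by
    intro i j hij
    simp only [g, Fin.mk.injEq] at hij
    split_ifs at hij <;> exact Fin.ext (by omega)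
  have := card_le_strongPartitionDim (tadpole_connected_and_dist hk hn).1
    (Finset.univ.image g) ?_ ⟨_, P, hP, rfl⟩
  · rwa [Finset.card_image_of_injective _ hg, Finset.card_univ, Fintype.card_fin] at this
  have hmem : ∀ x ∈ Finset.univ.image g, x.val = k ∨ 2 * k + L + 1 ≤ x.val := by
    intro x hx
    obtain ⟨i, -, rfl⟩ := Finset.mem_image.1 hx
    simp only [g]
    split_ifs <;> omega
  intro x hx y hy hxy w hw
  have hxy' := Fin.val_ne_of_ne hxy
  refine eq_or_eq_of_vertexStronglyResolves hk hn ?_ ?_ hw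
  · rcases hmem y hy with h | h
    · rw [h]
      exact isFarthest_end_left hk (by have := hmem x hx; omega) (by omega) cycleDist_zero_left
    · exact isFarthest_end hk h hxy'
  · rcases hmem x hx with h | h
    · rw [h]
      exact isFarthest_end_left hk (by have := hmem y hy; omega) (by omega) cycleDist_zero_left
    · exact isFarthest_end hk h hxy'.symm

/-! ### The strong metric dimension -/

/-- All these vertices lie on one geodesic from `k` through `0` to the path end, which therefore
resolves any two of them. -/
theorem tadpoleDist_line {k L x y : ℕ} (hx : x ≤ k ∨ 2 * k < x ∧ x ≤ 2 * k + L)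
    (hy : y ≤ k ∨ 2 * k < y ∧ y ≤ 2 * k + L) :
    tadpoleDist k L x (2 * k + L + 1) =
        tadpoleDist k L x y + tadpoleDist k L y (2 * k + L + 1) ∨
      tadpoleDist k L y (2 * k + L + 1) =
        tadpoleDist k L y x + tadpoleDist k L x (2 * k + L + 1) := by
  have key : ∀ v, v ≤ k ∨ 2 * k < v ∧ v ≤ 2 * k + L →
      tadpoleDist k L v (2 * k + L + 1) = if v ≤ k then v + L + 1 else 2 * k + L + 1 - v := by
    intro v hv
    simp only [tadpoleDist, height, cycleDist, foot]
    split_ifs <;> omega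
  rw [key x hx, key y hy, tadpoleDist_comm k L y x]
  simp only [tadpoleDist, height, cycleDist, foot]
  split_ifs <;> omega

theorem strongMetricDim_tadpole_le {k L s : ℕ} (hk : 2 ≤ k) :
    strongMetricDim (tadpole k L (2 * k + L + s + 2)) ≤ k + s + 1 := by
  obtain ⟨-, hd⟩ := tadpole_connected_and_dist (n := 2 * k + L + s + 2) (L := L) hk (by omega)
  let S : Finset (Fin (2 * k + L + s + 2)) := Finset.univ.filter fun v =>
    k + 1 ≤ v.val ∧ v.val ≤ 2 * k ∨ 2 * k + L + 1 ≤ v.val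
  have hS : ∀ v, v ∈ S ↔ k + 1 ≤ v.val ∧ v.val ≤ 2 * k ∨ 2 * k + L + 1 ≤ v.val := by
    intro v
    simp [S]
  have hcard : S.card ≤ (Finset.range (k + s + 1)).card := by
    refine Finset.card_le_card_of_injOn
      (fun v => if v.val ≤ 2 * k then v.val - (k + 1) else v.val - (k + L + 1)) ?_ ?_
    · intro v hv
      have := (hS v).1 hv
      simp only [Finset.coe_range, Set.mem_Iio]
      split_ifs <;> omega
    · intro v hv w hw h
      have := (hS v).1 hv
      have := (hS w).1 hw
      simp only at h
      split_ifs at h <;> exact Fin.ext (by omega)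
  rw [Finset.card_range] at hcard
  suffices hres : IsStrongResolvingSet (tadpole k L (2 * k + L + s + 2)) S by
    have hle : strongMetricDim (tadpole k L (2 * k + L + s + 2)) ≤ S.card :=
      Nat.sInf_le ⟨S, hres, rfl⟩
    exact hle.trans hcard
  intro x y hxy
  simp only [VertexStronglyResolves, hd]
  by_cases hx : x ∈ S
  · exact ⟨x, hx, Or.inr (by rw [tadpoleDist_self, add_zero])⟩
  by_cases hy : y ∈ S
  · exact ⟨y, hy, Or.inl (by rw [tadpoleDist_self, add_zero])⟩
  rw [hS] at hx hy
  exact ⟨⟨2 * k + L + 1, by omega⟩, (hS _).2 (Or.inr le_rfl),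
    tadpoleDist_line (by omega) (by omega)⟩

theorem le_card_of_isStrongResolvingSet {k L s : ℕ} (hk : 2 ≤ k)
    {S : Finset (Fin (2 * k + L + s + 2))}
    (hS : IsStrongResolvingSet (tadpole k L (2 * k + L + s + 2)) S) : k + s + 1 ≤ S.card := by
  have hn : 2 * k + L + 2 ≤ 2 * k + L + s + 2 := by omega
  have hindep : ∀ x ∈ Sᶜ, ∀ y ∈ Sᶜ, x.val ≠ y.val →
      IsFarthest k L x y → IsFarthest k L y x → False := by
    intro x hx y hy hxy h1 h2
    rw [Finset.mem_compl] at hx hy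
    obtain ⟨v, hv, hres⟩ := hS x y (fun e => hxy (congrArg _ e))
    rcases eq_or_eq_of_vertexStronglyResolves hk hn h1 h2 hres with rfl | rfl
    exacts [hx hv, hy hv]
  have hcyc : ∀ x ∈ Sᶜ, ∀ y ∈ Sᶜ, 0 < x.val → x.val < y.val → y.val ≤ 2 * k →
      y.val ≠ x.val + k ∧ y.val ≠ x.val + k + 1 := by
    intro x hx y hy h1 h2 h3
    by_contra hcon
    have e1 : cycleDist k x y = k := by
      simp only [cycleDist]
      omega
    have e2 : cycleDist k y x = k := by
      simp only [cycleDist]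
      omega
    exact hindep x hx y hy h2.ne (isFarthest_cycle (by omega) h3 (by omega) e1)
      (isFarthest_cycle h3 (by omega) (by omega) e2)
  have hend : ∀ x ∈ Sᶜ, ∀ y ∈ Sᶜ, 2 * k + L + 1 ≤ x.val → 2 * k + L + 1 ≤ y.val → x = y := by
    intro x hx y hy h1 h2
    by_contra hxy
    have hxy' := Fin.val_ne_of_ne hxy
    exact hindep x hx y hy hxy' (isFarthest_end hk h2 hxy') (isFarthest_end hk h1 hxy'.symm)
  have hapex : ∀ x ∈ Sᶜ, ∀ y ∈ Sᶜ, 2 * k + L + 1 ≤ x.val → y.val ≠ k ∧ y.val ≠ k + 1 := by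
    intro x hx y hy h1
    by_contra hcon
    have e1 : cycleDist k 0 y = k := by
      simp only [cycleDist]
      omega
    exact hindep x hx y hy (by omega) (isFarthest_end_left hk h1 (by omega) e1)
      (isFarthest_end hk h1 (by omega))
  have hcard : Sᶜ.card ≤ (Finset.range (k + L + 1)).card := by
    by_cases hex : ∃ z ∈ Sᶜ, 2 * k + L + 1 ≤ z.val
    · obtain ⟨z, hz, hzl⟩ := hex
      -- An end outside `S` excludes `k` and `k + 1`. The map merges the forbidden pairs `i`, `i + k
      -- + 1` and sends every end to `k + L`.
      refine Finset.card_le_card_of_injOn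
        (fun v => if v.val < k then v.val else min (v.val - (k + 1)) (k + L)) ?_ ?_
      · intro v hv
        simp only [Finset.coe_range, Set.mem_Iio]
        split_ifs <;> omega
      · intro v hv w hw h
        have h1 := hapex z hz v hv hzl
        have h2 := hapex z hz w hw hzl
        have h3 := hcyc v hv w hw
        have h4 := hcyc w hw v hv
        have h5 := hend v hv w hw
        rw [Fin.ext_iff] at h5 ⊢
        simp only at h
        split_ifs at h <;> omega
    · push Not at hex
      -- With all ends in `S`, merge the forbidden pairs `i`, `i + k` instead.
      refine Finset.card_le_card_of_injOn
        (fun v => if v.val ≤ k then v.val else v.val - k) ?_ ?_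
      · intro v hv
        have := hex v hv
        simp only [Finset.coe_range, Set.mem_Iio]
        split_ifs <;> omega
      · intro v hv w hw h
        have h3 := hcyc v hv w hw
        have h4 := hcyc w hw v hv
        have h5 := hex v hv
        have h6 := hex w hw
        rw [Fin.ext_iff]
        simp only at h
        split_ifs at h <;> omega
  rw [Finset.card_range] at hcard
  have := Finset.card_add_card_compl S
  rw [Fintype.card_fin] at this
  omega

theorem strongMetricDim_tadpole {k L s : ℕ} (hk : 2 ≤ k) :
    strongMetricDim (tadpole k L (2 * k + L + s + 2)) = k + s + 1 := by
  refine le_antisymm (strongMetricDim_tadpole_le hk) (le_csInf ⟨_, Finset.univ, ?_, rfl⟩ ?_)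
  · exact fun x y _ => ⟨x, Finset.mem_univ x, Or.inr (by rw [SimpleGraph.dist_self, add_zero])⟩
  · rintro _ ⟨S, hS, rfl⟩
    exact le_card_of_isStrongResolvingSet hk hS

end StrongPartition

theorem mainTheorem9 (r t n : ℕ) (hr : 3 ≤ r) (hrt : r < t)
    (htn : (t : ℚ) ≤ ((n : ℚ) + (r : ℚ) - 2) / 2) :
    ∃ G : SimpleGraph (Fin n), G.Connected ∧
      StrongPartition.strongPartitionDim G = r ∧ StrongPartition.strongMetricDim G = t := by
  have h : 2 * t + 2 ≤ n + r := by
    have : (2 * t + 2 : ℚ) ≤ n + r := by linarith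
    exact_mod_cast this
  obtain ⟨s, rfl⟩ := Nat.exists_eq_add_of_le' (by omega : 2 ≤ r)
  obtain ⟨k, rfl⟩ := Nat.exists_eq_add_of_le' (by omega : s + 1 ≤ t)
  obtain ⟨L, hL⟩ := Nat.exists_eq_add_of_le' (by omega : 2 * k + s + 2 ≤ n)
  obtain rfl : n = 2 * k + L + s + 2 := by omega
  have hk : 2 ≤ k := by omega
  exact ⟨StrongPartition.tadpole k L _,
    (StrongPartition.tadpole_connected_and_dist hk (by omega)).1,
    StrongPartition.strongPartitionDim_tadpole hk (by omega),
    StrongPartition.strongMetricDim_tadpole hk⟩
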